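/- Let $n\ge 1$ and $\lambda>0$. Let $R_\lambda>0$ be the radius of the balls of $\mathbb{R}^n$ whose first Dirichlet eigenvalue of the Laplacian is $\lambda$; that is, $R_\lambda$ is the positive number $R$ for which the problem $\Delta v+\lambda v=0$, $v>0$ in $B_R(0)$, $v=0$ on $\partial B_R(0)$ has a solution $v\in C^2(B_R(0))\cap C^0(\overline{B_R(0)})$. Let $f:(0,+\infty)\to\mathbb{R}$ be a function with $f(t)\ge\lambda t$ for all $t>0$, let $\Omega\subset\mathbb{R}^n$ be a (bounded or unbounded) connected open set, and let $u\in C^2(\Omega)$ satisfy $u>0$ and $\Delta u+f(u)=0$ in $\Omega$. Then: (1) $\Omega$ does not contain any closed ball of radius $R_\lambda$. (2) Suppose moreover that $\partial\Omega$ is of class $C^1$ (with $\Omega$ locally on one side of it), that $u\in C^1(\overline\Omega)$, and that, for some constant $\alpha<0$, $u=0$ and $\langle\nabla u,\nu\rangle=\alpha$ on $\partial\Omega$, where $\nu$ is the outward unit normal. Then either $\overline\Omega$ does not contain any closed ball of radius $R_\lambda$, or $\Omega$ is a ball of radius $R_\lambda$. -/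

import Mathlib

open Set Filter Topology
open scoped InnerProductSpace

/-- Euclidean space `ℝⁿ`. -/
abbrev Euc (n : ℕ) : Type := EuclideanSpace ℝ (Fin n)

/-- `R` is the radius `R_λ` associated with `lam`: it is positive, and on the open ball of
radius `R` of `ℝⁿ` there is a classical solution `v` (of class `C²` inside, continuous up to the
boundary) of `Δ v + lam v = 0`, `v > 0` in the ball, `v = 0` on the boundary sphere. Equivalently,
`lam` is the first Dirichlet eigenvalue of the ball of radius `R`. -/
def IsDirichletRadius (n : ℕ) (lam R : ℝ) : Prop :=
  0 < R ∧ ∃ v : Euc n → ℝ,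
    ContDiffOn ℝ 2 v (Metric.ball 0 R) ∧
    ContinuousOn v (Metric.closedBall 0 R) ∧
    (∀ x ∈ Metric.ball (0 : Euc n) R, Laplacian.laplacian v x + lam * v x = 0) ∧
    (∀ x ∈ Metric.ball (0 : Euc n) R, 0 < v x) ∧
    (∀ x ∈ Metric.sphere (0 : Euc n) R, v x = 0)

/-- `ρ` is a `C¹` defining function of `Ω` near the boundary point `q`: `ρ` is `C¹` near `q`,
vanishes at `q`, has nonzero differential there, and `Ω` is `{ρ < 0}` near `q`. -/
def IsDefiningFunctionAt {n : ℕ} (Ω : Set (Euc n)) (q : Euc n) (ρ : Euc n → ℝ) : Prop :=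
  ContDiffAt ℝ 1 ρ q ∧ ρ q = 0 ∧ gradient ρ q ≠ 0 ∧ ∀ᶠ x in 𝓝 q, (x ∈ Ω ↔ ρ x < 0)

/-- The boundary of `Ω` is of class `C¹` (and `Ω` lies locally on one side of it). -/
def HasC1Boundary {n : ℕ} (Ω : Set (Euc n)) : Prop :=
  ∀ q ∈ frontier Ω, ∃ ρ : Euc n → ℝ, IsDefiningFunctionAt Ω q ρ

/-- `ν` is the unit normal vector to the boundary of `Ω` at `q` that points out of `Ω`. -/
def IsOutwardUnitNormal {n : ℕ} (Ω : Set (Euc n)) (q ν : Euc n) : Prop :=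
  ∃ ρ : Euc n → ℝ, IsDefiningFunctionAt Ω q ρ ∧ ν = ‖gradient ρ q‖⁻¹ • gradient ρ q

/-- The overdetermined boundary conditions `u = 0` and `⟨∇u, ν⟩ = α` on `∂Ω`; the gradient at a
boundary point is the one of `u` on the closure of `Ω`. -/
def OverdeterminedBoundary {n : ℕ} (Ω : Set (Euc n)) (u : Euc n → ℝ) (α : ℝ) : Prop :=
  ∀ q ∈ frontier Ω, u q = 0 ∧
    ∀ ν : Euc n, IsOutwardUnitNormal Ω q ν → ⟪gradientWithin u (closure Ω) q, ν⟫_ℝ = α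

section ExistenceOfRadius

/-- Coefficients of the entire solution of `t g'' + c g' + g = 0`, `g 0 = 1`. -/
noncomputable def besselCoeff (c : ℝ) : ℕ → ℝ
  | 0 => 1
  | k + 1 => - besselCoeff c k / ((k + 1) * (c + k))

theorem abs_besselCoeff_le {c : ℝ} (hc : 0 < c) (k : ℕ) :
    |besselCoeff c k| ≤ 1 * (1 / c) ^ k / k.factorial := by
  induction k with
  | zero => simp [besselCoeff]
  | succ k ih =>
    have hk : (0 : ℝ) < k + 1 := by positivity
    have hck : 0 < c + k := by positivity
    have h1 : |besselCoeff c (k + 1)| = |besselCoeff c k| / ((k + 1) * (c + k)) := by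
      rw [besselCoeff, abs_div, abs_neg, abs_of_pos (mul_pos hk hck)]
    rw [h1]
    calc |besselCoeff c k| / ((k + 1) * (c + k))
        ≤ (1 * (1 / c) ^ k / k.factorial) / ((k + 1) * c) := by
          gcongr
          simp
      _ = 1 * (1 / c) ^ (k + 1) / (k + 1).factorial := by
          rw [Nat.factorial_succ, pow_succ]
          push_cast
          field_simp

theorem hasDerivAt_entire {a : ℕ → ℝ} {M C : ℝ} (hC : 0 ≤ C)
    (ha : ∀ k, |a k| ≤ M * C ^ k / k.factorial) (t : ℝ) :
    HasDerivAt (fun s : ℝ => ∑' k, a k * s ^ k) (∑' k, ((k + 1) * a (k + 1)) * t ^ k) t := by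
  have hM : 0 ≤ M := by simpa using (abs_nonneg _).trans (ha 0)
  set r : ℝ := |t| + 1 with hr
  have hr0 : 0 ≤ r := by positivity
  have hsum : Summable (fun k : ℕ => M * C ^ k / k.factorial * (k * r ^ (k - 1))) := by
    rw [← summable_nat_add_iff 1]
    have := (Real.summable_pow_div_factorial (C * r)).mul_left (M * C)
    refine this.congr fun k => ?_
    rw [Nat.factorial_succ]
    push_cast
    rw [pow_succ, mul_pow]
    field_simp
  have key := hasDerivAt_tsum_of_isPreconnected (g := fun k s => a k * s ^ k)
    (g' := fun k s => a k * (k * s ^ (k - 1))) (y₀ := 0) (y := t) hsum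
    (Metric.isOpen_ball (x := (0 : ℝ)) (ε := r)) (convex_ball 0 r).isPreconnected
    (fun k s _ => (hasDerivAt_pow k s).const_mul (a k))
    (fun k s hs => by
      have hs' : |s| ≤ r := by
        have := Metric.mem_ball.1 hs
        rw [Real.dist_eq, sub_zero] at this
        exact this.le
      rw [Real.norm_eq_abs, abs_mul, abs_mul, abs_pow, Nat.abs_cast]
      have := ha k
      gcongr)
    (by simp [hr]; positivity)
    (by
      refine summable_of_ne_finset_zero (s := {0}) fun k hk => ?_
      have : k ≠ 0 := by simpa using hk
      simp [this])
    (by simp [hr])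
  have hs2 : Summable (fun k : ℕ => a k * (k * t ^ (k - 1))) := by
    refine Summable.of_norm_bounded hsum fun k => ?_
    rw [Real.norm_eq_abs, abs_mul, abs_mul, abs_pow, Nat.abs_cast]
    have := ha k
    have h2 : |t| ≤ r := by simp [hr]
    gcongr
  have heq : ∑' k, ((k + 1) * a (k + 1)) * t ^ k = ∑' k : ℕ, a k * (k * t ^ (k - 1)) := by
    rw [hs2.tsum_eq_zero_add]
    simp only [Nat.cast_zero, zero_mul, mul_zero, zero_add]
    refine tsum_congr fun k => ?_
    push_cast
    ring
  rw [heq]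
  exact key

theorem abs_shift_le {a : ℕ → ℝ} {M C : ℝ}
    (ha : ∀ k, |a k| ≤ M * C ^ k / k.factorial) (k : ℕ) :
    |((k : ℝ) + 1) * a (k + 1)| ≤ (M * C) * C ^ k / k.factorial := by
  have hk : (0 : ℝ) < k + 1 := by positivity
  rw [abs_mul, abs_of_pos hk]
  calc ((k : ℝ) + 1) * |a (k + 1)| ≤ (k + 1) * (M * C ^ (k + 1) / (k + 1).factorial) := by
        gcongr
        exact ha _
    _ = (M * C) * C ^ k / k.factorial := by
        rw [Nat.factorial_succ, pow_succ]
        push_cast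
        field_simp

theorem summable_entire {a : ℕ → ℝ} {M C : ℝ}
    (ha : ∀ k, |a k| ≤ M * C ^ k / k.factorial) (t : ℝ) :
    Summable (fun k => a k * t ^ k) := by
  refine Summable.of_norm_bounded ((Real.summable_pow_div_factorial (C * |t|)).mul_left M)
    fun k => ?_
  rw [Real.norm_eq_abs, abs_mul, abs_pow]
  calc |a k| * |t| ^ k ≤ (M * C ^ k / k.factorial) * |t| ^ k := by
        gcongr
        exact ha k
    _ = _ := by rw [mul_pow]; ring

/-- An entire solution of `t g'' + c g' + g = 0` with `g 0 = 1`. -/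
theorem exists_bessel {c : ℝ} (hc : 0 < c) : ∃ g g' g'' : ℝ → ℝ, g 0 = 1 ∧ ContDiff ℝ 2 g ∧
    (∀ t, HasDerivAt g (g' t) t) ∧ (∀ t, HasDerivAt g' (g'' t) t) ∧
    ∀ t, t * g'' t + c * g' t + g t = 0 := by
  have hC : 0 ≤ 1 / c := by positivity
  have ha := abs_besselCoeff_le hc
  set a := besselCoeff c with ha_def
  have hb := abs_shift_le ha
  have hd := abs_shift_le hb
  have he := abs_shift_le hd
  have h1 := hasDerivAt_entire hC ha
  have h2 := hasDerivAt_entire hC hb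
  have h3 := hasDerivAt_entire hC hd
  have hcd : ContDiff ℝ 2 (fun s : ℝ => ∑' k, a k * s ^ k) := by
    rw [show (2 : WithTop ℕ∞) = 1 + 1 by norm_num, contDiff_succ_iff_deriv]
    refine ⟨fun t => (h1 t).differentiableAt, by simp, ?_⟩
    rw [funext fun t => (h1 t).deriv, contDiff_one_iff_deriv]
    refine ⟨fun t => (h2 t).differentiableAt, ?_⟩
    rw [funext fun t => (h2 t).deriv]
    exact continuous_iff_continuousAt.2 fun t => (h3 t).continuousAt
  refine ⟨_, _, _, ?_, hcd, h1, h2, fun t => ?_⟩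
  · rw [tsum_eq_single 0 (fun k hk => by simp [hk])]
    simp [ha_def, besselCoeff]
  · have s0 := summable_entire ha t
    have s1 := summable_entire hb t
    have s2 := summable_entire hd t
    have s3 : Summable (fun k : ℕ => (k * ((k + 1) * a (k + 1))) * t ^ k) := by
      rw [← summable_nat_add_iff 1]
      refine (s2.mul_left t).congr fun k => ?_
      push_cast
      ring
    have e3 : t * ∑' k : ℕ, ((k : ℝ) + 1) * (((k + 1 : ℕ) + 1) * a (k + 1 + 1)) * t ^ k
        = ∑' k : ℕ, (k * ((k + 1) * a (k + 1))) * t ^ k := by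
      rw [s3.tsum_eq_zero_add, ← tsum_mul_left]
      simp only [Nat.cast_zero, zero_mul, zero_add]
      refine tsum_congr fun k => ?_
      push_cast
      ring
    rw [e3, ← tsum_mul_left, ← s3.tsum_add (s1.mul_left c), ← (s3.add (s1.mul_left c)).tsum_add s0]
    refine (tsum_congr fun k => ?_).trans tsum_zero
    have hk : (0 : ℝ) < k + 1 := by positivity
    have hck : 0 < c + k := by positivity
    have : a (k + 1) = - a k / ((k + 1) * (c + k)) := by rw [ha_def, besselCoeff]
    rw [this]
    field_simp
    ring

/-- Such a solution does not stay positive on the half-line. -/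
theorem exists_bessel_nonpos {c : ℝ} {g g' g'' : ℝ → ℝ}
    (h1 : ∀ t, HasDerivAt g (g' t) t) (h2 : ∀ t, HasDerivAt g' (g'' t) t)
    (hode : ∀ t, t * g'' t + c * g' t + g t = 0) : ∃ t, 0 ≤ t ∧ g t ≤ 0 := by
  by_contra! hpos
  set T : ℝ := 1 / 2 + (c - 1) ^ 2 / 2 with hT
  have hT0 : 0 < T := by positivity
  set h : ℝ → ℝ := fun t => -(t * g' t) / g t with hh
  set F : ℝ → ℝ := fun t => Real.arctan (h t) - Real.log t / 2 with hF
  have hder : ∀ t, 0 < t → HasDerivAt F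
      (1 / (1 + h t ^ 2) * (((h t) ^ 2 + (1 - c) * h t + t) / t) - t⁻¹ / 2) t := by
    intro t ht
    have hg := (hpos t ht.le).ne'
    have hd : HasDerivAt h (((h t) ^ 2 + (1 - c) * h t + t) / t) t := by
      have := ((((hasDerivAt_id t).mul (h2 t)).neg).div (h1 t) hg)
      refine this.congr_deriv ?_
      have ho := hode t
      have : t * g'' t = -(c * g' t) - g t := by linarith
      simp only [hh, id, Pi.mul_apply, Pi.neg_apply, this, one_mul]
      field_simp
      ring
    exact hd.arctan.sub ((Real.hasDerivAt_log ht.ne').div_const 2)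
  have hmono : MonotoneOn F (Ici T) := by
    refine monotoneOn_of_deriv_nonneg (convex_Ici T)
      (fun t ht => (hder t (hT0.trans_le ht)).continuousAt.continuousWithinAt)
      (fun t ht => ?_) (fun t ht => ?_)
    · rw [interior_Ici] at ht
      exact (hder t (hT0.trans ht)).differentiableAt.differentiableWithinAt
    · rw [interior_Ici] at ht
      have ht0 : 0 < t := hT0.trans ht
      rw [(hder t ht0).deriv]
      have hpos2 : 0 < 1 + h t ^ 2 := by positivity
      have : 1 / (1 + h t ^ 2) * (((h t) ^ 2 + (1 - c) * h t + t) / t) - t⁻¹ / 2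
          = (((h t) ^ 2 + (1 - c) * h t + t) - (1 + h t ^ 2) / 2) / ((1 + h t ^ 2) * t) := by
        field_simp
      rw [this]
      refine div_nonneg ?_ (by positivity)
      have : T < t := ht
      nlinarith [sq_nonneg (h t + (1 - c))]
  have hexp : 1 ≤ Real.exp (2 * Real.pi) := Real.one_le_exp (by positivity)
  have hle : T ≤ T * Real.exp (2 * Real.pi) := le_mul_of_one_le_right hT0.le hexp
  have := hmono (mem_Ici.2 le_rfl) (mem_Ici.2 hle) hle
  simp only [hF] at this
  rw [Real.log_mul hT0.ne' (Real.exp_pos _).ne', Real.log_exp] at this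
  have b1 := Real.arctan_lt_pi_div_two (h (T * Real.exp (2 * Real.pi)))
  have b2 := Real.neg_pi_div_two_lt_arctan (h T)
  linarith

/-- Laplacian of a radial function written in terms of `‖x‖²`. -/
theorem laplacian_radial {n : ℕ} {g g' g'' : ℝ → ℝ} (h1 : ∀ t, HasDerivAt g (g' t) t)
    (h2 : ∀ t, HasDerivAt g' (g'' t) t) (x : Euc n) :
    Laplacian.laplacian (fun y : Euc n => g (‖y‖ ^ 2)) x
      = 4 * ‖x‖ ^ 2 * g'' (‖x‖ ^ 2) + 2 * n * g' (‖x‖ ^ 2) := by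
  have hn : ∀ y : Euc n, HasFDerivAt (fun y : Euc n => ‖y‖ ^ 2) (2 • (innerSL ℝ y)) y :=
    fun y => (hasStrictFDerivAt_norm_sq y).hasFDerivAt
  have d1 : fderiv ℝ (fun y : Euc n => g (‖y‖ ^ 2))
      = fun y => g' (‖y‖ ^ 2) • ((2 : ℝ) • innerSL ℝ y) := by
    funext y
    have := ((h1 (‖y‖ ^ 2)).comp_hasFDerivAt y (hn y)).fderiv
    rw [show (fun y : Euc n => g (‖y‖ ^ 2)) = g ∘ fun y => ‖y‖ ^ 2 from rfl, this]
    congr 1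
    rw [two_smul, two_smul]
  let L : Euc n →L[ℝ] (Euc n →L[ℝ] ℝ) := LinearMap.toContinuousLinearMap
    { toFun := fun y => innerSL ℝ y
      map_add' := fun y z => by simp
      map_smul' := fun r y => by simp }
  have hL : ∀ y, L y = innerSL ℝ y := fun y => rfl
  have d2 : HasFDerivAt (fun y : Euc n => g' (‖y‖ ^ 2) • ((2 : ℝ) • innerSL ℝ y))
      (g' (‖x‖ ^ 2) • ((2 : ℝ) • L)
        + (g'' (‖x‖ ^ 2) • (2 • innerSL ℝ x)).smulRight ((2 : ℝ) • innerSL ℝ x)) x := by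
    have e1 := (h2 (‖x‖ ^ 2)).comp_hasFDerivAt x (hn x)
    have e2 : HasFDerivAt (fun y : Euc n => (2 : ℝ) • innerSL ℝ y) ((2 : ℝ) • L) x :=
      ((2 : ℝ) • L).hasFDerivAt
    exact e1.smul e2
  rw [InnerProductSpace.laplacian_eq_iteratedFDeriv_orthonormalBasis _
    (EuclideanSpace.basisFun (Fin n) ℝ)]
  simp only [iteratedFDeriv_two_apply, d1, d2.fderiv]
  simp only [Matrix.cons_val_zero, Matrix.cons_val_one, EuclideanSpace.basisFun_apply,
    add_apply, smul_apply,
    ContinuousLinearMap.smulRight_apply, hL, innerSL_apply_apply, smul_eq_mul]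
  rw [EuclideanSpace.norm_sq_eq]
  simp only [EuclideanSpace.inner_single_right]
  simp [Finset.sum_add_distrib, Finset.mul_sum, Finset.sum_mul]
  rw [add_comm]
  congr 1
  · refine Finset.sum_congr rfl fun i _ => ?_
    ring
  · ring

/-- The radius of the definition exists in every dimension `n ≥ 1` and for every `lam > 0`, with
an eigenfunction that is smooth beyond the ball. -/
theorem exists_isDirichletRadius {n : ℕ} (hn : 0 < n) {lam : ℝ} (hlam : 0 < lam) :
    ∃ R : ℝ, 0 < R ∧ IsDirichletRadius n lam R ∧ ∃ v : Euc n → ℝ, ContDiff ℝ 2 v ∧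
      (∀ x, Laplacian.laplacian v x + lam * v x = 0) ∧
      (∀ x ∈ Metric.ball (0 : Euc n) R, 0 < v x) ∧
      (∀ x ∈ Metric.sphere (0 : Euc n) R, v x = 0) := by
  have hc : (0 : ℝ) < n / 2 := by positivity
  obtain ⟨g, g', g'', hg0, hcd, h1, h2, hode⟩ := exists_bessel hc
  obtain ⟨t₁, ht₁, hgt₁⟩ := exists_bessel_nonpos h1 h2 hode
  have hcont : Continuous g := hcd.continuous
  set S : Set ℝ := {t | 0 ≤ t ∧ g t ≤ 0} with hS
  have hSc : IsClosed S := (isClosed_Ici).inter (isClosed_le hcont continuous_const)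
  have hSb : BddBelow S := ⟨0, fun t ht => ht.1⟩
  have hmem : sInf S ∈ S := hSc.csInf_mem ⟨t₁, ht₁, hgt₁⟩ hSb
  set τ := sInf S with hτ
  have hτ0 : 0 < τ := by
    refine lt_of_le_of_ne hmem.1 fun h => ?_
    have := hmem.2
    rw [← h, hg0] at this
    linarith
  have hlt : ∀ t, 0 ≤ t → t < τ → 0 < g t := fun t ht htτ => by
    by_contra hcon
    exact absurd (csInf_le hSb (show t ∈ S from ⟨ht, not_lt.1 hcon⟩)) (not_le.2 htτ)
  have hz : g τ = 0 := by
    refine le_antisymm hmem.2 ?_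
    have hcl : τ ∈ closure (Ico 0 τ) := by
      rw [closure_Ico hτ0.ne]
      exact ⟨hτ0.le, le_rfl⟩
    exact closure_minimal (fun t ht => (hlt t ht.1 ht.2).le)
      (isClosed_le continuous_const hcont) hcl
  set R : ℝ := Real.sqrt (4 * τ / lam) with hR
  have hR0 : 0 < R := Real.sqrt_pos.2 (by positivity)
  have hR2 : lam / 4 * R ^ 2 = τ := by
    rw [hR, Real.sq_sqrt (by positivity)]
    field_simp
  set v : Euc n → ℝ := fun y => g (lam / 4 * ‖y‖ ^ 2) with hv
  have vcd : ContDiff ℝ 2 v := hcd.comp (contDiff_const.mul (contDiff_norm_sq ℝ))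
  have veq : ∀ x, Laplacian.laplacian v x + lam * v x = 0 := by
    intro x
    have k1 : ∀ t, HasDerivAt (fun s => g (lam / 4 * s)) (g' (lam / 4 * t) * (lam / 4)) t :=
      fun t => (h1 _).comp t (by simpa using (hasDerivAt_id t).const_mul (lam / 4))
    have k2 : ∀ t, HasDerivAt (fun s => g' (lam / 4 * s) * (lam / 4))
        (g'' (lam / 4 * t) * (lam / 4) * (lam / 4)) t :=
      fun t => ((h2 _).comp t
        (by simpa using (hasDerivAt_id t).const_mul (lam / 4))).mul_const _
    have hl := laplacian_radial (n := n) k1 k2 x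
    have := hode (lam / 4 * ‖x‖ ^ 2)
    rw [hv, hl]
    linear_combination lam * this
  have vpos : ∀ x ∈ Metric.ball (0 : Euc n) R, 0 < v x := by
    intro x hx
    rw [mem_ball_zero_iff] at hx
    refine hlt _ (by positivity) ?_
    rw [← hR2]
    gcongr
  have vzero : ∀ x ∈ Metric.sphere (0 : Euc n) R, v x = 0 := by
    intro x hx
    rw [mem_sphere_zero_iff_norm] at hx
    rw [hv]
    simp only [hx, hR2, hz]
  exact ⟨R, hR0, ⟨hR0, v, vcd.contDiffOn, vcd.continuous.continuousOn, fun x _ => veq x, vpos,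
    vzero⟩, v, vcd, veq, vpos, vzero⟩

end ExistenceOfRadius

/-! Since `f t ≥ lam * t`, `u` is a positive supersolution: `Δu + lam u ≤ 0`. On a ball of radius
`R` compare it with a first eigenfunction `v`. If `c` is the least constant with `v ≤ c u`, then
`Δ(c u - v) ≤ -lam (c u - v) ≤ 0`, so `c u - v` is nonnegative and superharmonic, and the strong
minimum principle (`pos_or_eq_zero_of_superharmonic`) applies.

If the closed ball lies in `Ω`, `v/u` attains its maximum `c`, at an interior point because `v = 0`
on the sphere. Hence `c u = v` in the ball, and by continuity `u = 0` on the sphere, a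
contradiction.

If the closed ball lies only in the closure of `Ω`, the `C¹` boundary still puts the open ball in
`Ω`, but `u` may vanish on the sphere. Hopf's lemma (`exists_mul_sub_norm_le_of_superharmonic`)
bounds `u` below, and smoothness bounds `v` above, by multiples of the distance to the sphere, so `c
= sup v/u` is finite. A second use of Hopf, on `c u - v`, contradicts minimality of `c` unless `u`
is a multiple of `v`. Then `u = 0` on the sphere, which therefore misses `Ω`, and connectedness
leaves only the ball. -/

/-! ### Second derivative test. -/

/-- Second derivative test: the second derivative is nonnegative at a local minimum. -/
theorem IsLocalMin.deriv_deriv_nonneg {φ : ℝ → ℝ} {a : ℝ} (h : IsLocalMin φ a)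
    (hc : ContinuousAt φ a) : 0 ≤ deriv (deriv φ) a := by
  by_contra! hneg
  -- The point would also be a local maximum, so `φ` would be locally constant and its second
  -- derivative zero.
  have hmax := isLocalMax_of_deriv_deriv_neg hneg h.deriv_eq_zero hc
  have hconst : φ =ᶠ[𝓝 a] fun _ => φ a := by
    filter_upwards [h, hmax] with t h1 h2 using le_antisymm h2 h1
  have h1 : deriv φ =ᶠ[𝓝 a] fun _ => 0 := by
    simpa using hconst.deriv
  have h2 := h1.deriv_eq
  simp only [deriv_const] at h2
  linarith

theorem iteratedFDeriv_two_nonneg_of_isLocalMin {E : Type*} [NormedAddCommGroup E]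
    [NormedSpace ℝ E] {f : E → ℝ} {x : E} (hf : ContDiffAt ℝ 2 f x) (h : IsLocalMin f x) (e : E) :
    0 ≤ iteratedFDeriv ℝ 2 f x ![e, e] := by
  have hline : ∀ t : ℝ, HasDerivAt (fun s : ℝ => x + s • e) e t := fun t => by
    simpa using ((hasDerivAt_id t).smul_const e).const_add x
  have htend : Tendsto (fun s : ℝ => x + s • e) (𝓝 0) (𝓝 x) := by
    simpa using (hline 0).continuousAt.tendsto
  have hmin : IsLocalMin (fun s : ℝ => f (x + s • e)) 0 := by
    have := htend.eventually h
    simpa [IsLocalMin, IsMinFilter] using this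
  have hd1 : deriv (fun s : ℝ => f (x + s • e)) =ᶠ[𝓝 0] fun s => fderiv ℝ f (x + s • e) e := by
    have hev : ∀ᶠ y in 𝓝 x, DifferentiableAt ℝ f y :=
      (hf.eventually (by simp)).mono fun y hy => hy.differentiableAt (by simp)
    filter_upwards [htend.eventually hev] with s hs
    exact (hs.hasFDerivAt.comp_hasDerivAt s (hline s)).deriv
  have hf' : DifferentiableAt ℝ (fderiv ℝ f) x :=
    (hf.fderiv_right (m := 1) (by norm_num)).differentiableAt (by simp)
  have hd2 : HasDerivAt (fun s : ℝ => fderiv ℝ f (x + s • e) e)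
      (fderiv ℝ (fderiv ℝ f) x e e) 0 := by
    have h0 : HasFDerivAt (fderiv ℝ f) (fderiv ℝ (fderiv ℝ f) x) (x + (0 : ℝ) • e) := by
      simpa using hf'.hasFDerivAt
    have := h0.comp_hasDerivAt (0 : ℝ) (hline 0)
    simpa using this.clm_apply (hasDerivAt_const (0 : ℝ) e)
  have hcont : ContinuousAt (fun s : ℝ => f (x + s • e)) 0 := by
    have : ContinuousAt f (x + (0 : ℝ) • e) := by simpa using hf.continuousAt
    exact ContinuousAt.comp (f := fun s : ℝ => x + s • e) this (hline 0).continuousAt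
  have key := hmin.deriv_deriv_nonneg hcont
  rw [hd1.deriv_eq, hd2.deriv] at key
  simpa [iteratedFDeriv_two_apply] using key

/-! ### Hopf's lemma and the strong minimum principle. -/

section SuperharmonicFunctions

variable {n : ℕ}

theorem laplacian_nonneg_of_isLocalMin {f : Euc n → ℝ} {x : Euc n} (hf : ContDiffAt ℝ 2 f x)
    (h : IsLocalMin f x) : 0 ≤ Laplacian.laplacian f x := by
  rw [InnerProductSpace.laplacian_eq_iteratedFDeriv_orthonormalBasis _
    (EuclideanSpace.basisFun (Fin n) ℝ)]
  exact Finset.sum_nonneg fun i _ => iteratedFDeriv_two_nonneg_of_isLocalMin hf h _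

theorem laplacian_comp_const_add (f : Euc n → ℝ) (p x : Euc n) :
    Laplacian.laplacian (fun y => f (p + y)) x = Laplacian.laplacian f (p + x) := by
  simp [InnerProductSpace.laplacian_eq_iteratedFDeriv_stdOrthonormalBasis,
    iteratedFDeriv_comp_add_left]

theorem laplacian_const_mul_sub {f g : Euc n → ℝ} {x : Euc n} (c : ℝ) (hf : ContDiffAt ℝ 2 f x)
    (hg : ContDiffAt ℝ 2 g x) :
    Laplacian.laplacian (fun y => c * f y - g y) x
      = c * Laplacian.laplacian f x - Laplacian.laplacian g x := by
  have h1 : ContDiffAt ℝ 2 (c • f) x := contDiffAt_const.smul hf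
  have := h1.laplacian_sub hg
  rw [InnerProductSpace.laplacian_smul c hf] at this
  exact this

/-- The Gaussian is strictly subharmonic away from a small ball. -/
theorem laplacian_gaussian_sub_pos {a s : ℝ} (ha : 0 < a) {x : Euc n}
    (hx : (n : ℝ) < 2 * a * ‖x‖ ^ 2) :
    0 < Laplacian.laplacian (fun y : Euc n => Real.exp (-a * ‖y‖ ^ 2) - s) x := by
  have h1 : ∀ t, HasDerivAt (fun t : ℝ => Real.exp (-a * t) - s)
      (Real.exp (-a * t) * -a) t := fun t => by
    simpa using (((hasDerivAt_id t).const_mul (-a)).exp).sub_const s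
  have h2 : ∀ t, HasDerivAt (fun t : ℝ => Real.exp (-a * t) * -a)
      (Real.exp (-a * t) * -a * -a) t := fun t => by
    simpa using (((hasDerivAt_id t).const_mul (-a)).exp).mul_const (-a)
  rw [laplacian_radial h1 h2 x]
  have : 0 < Real.exp (-a * ‖x‖ ^ 2) * (2 * a) * (2 * a * ‖x‖ ^ 2 - n) := by
    have := Real.exp_pos (-a * ‖x‖ ^ 2)
    have h3 : 0 < 2 * a * ‖x‖ ^ 2 - n := by linarith
    positivity
  linarith

/-- Hopf's lemma on a ball: a nonnegative superharmonic function that is positive at the centre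
grows at least linearly in the distance to the boundary. -/
theorem exists_mul_sub_norm_le_of_superharmonic {ρ : ℝ} (hρ : 0 < ρ) {w : Euc n → ℝ}
    (hw : ContDiffOn ℝ 2 w (Metric.ball 0 ρ))
    (hsuper : ∀ x ∈ Metric.ball (0 : Euc n) ρ, Laplacian.laplacian w x ≤ 0)
    (hnonneg : ∀ x ∈ Metric.ball (0 : Euc n) ρ, 0 ≤ w x) (hcentre : 0 < w 0) :
    ∃ ε > 0, ∀ x ∈ Metric.ball (0 : Euc n) ρ, ε * (ρ - ‖x‖) ≤ w x := by
  have hwAt : ∀ x ∈ Metric.ball (0 : Euc n) ρ, ContDiffAt ℝ 2 w x := fun x hx =>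
    hw.contDiffAt (Metric.isOpen_ball.mem_nhds hx)
  obtain ⟨r, hr, hwr⟩ : ∃ r > 0, ∀ x : Euc n, ‖x‖ < r → w 0 / 2 < w x := by
    have := (hwAt 0 (Metric.mem_ball_self hρ)).continuousAt.eventually
      (lt_mem_nhds (half_lt_self hcentre))
    obtain ⟨r, hr, h⟩ := Metric.eventually_nhds_iff.1 this
    exact ⟨r, hr, fun x hx => h (by simpa using hx)⟩
  set δ := w 0 / 2 with hδ
  have hδ0 : 0 < δ := half_pos hcentre
  set r₁ := r / 2 with hr₁
  have hr₁0 : 0 < r₁ := half_pos hr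
  have hr₁r : r₁ < r := half_lt_self hr
  -- Chosen so that `2 * a * r₁ ^ 2 = n + 1 > n`: the Gaussian is strictly subharmonic wherever `r₁
  -- ≤ ‖x‖`.
  set a := (n + 1 : ℝ) / (2 * r₁ ^ 2) with ha
  have ha0 : 0 < a := by positivity
  have ha1 : ∀ x : Euc n, r₁ ≤ ‖x‖ → (n : ℝ) < 2 * a * ‖x‖ ^ 2 := fun x hx => by
    have h1 : 2 * a * r₁ ^ 2 = n + 1 := by rw [ha]; field_simp
    have h2 : 2 * a * r₁ ^ 2 ≤ 2 * a * ‖x‖ ^ 2 := by gcongr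
    linarith
  have hexp : ∀ s : ℝ, ∀ x : Euc n, Real.exp (-a * ‖x‖ ^ 2) - Real.exp (-a * s ^ 2) ≤ 1 := by
    intro s x
    have h1 : Real.exp (-a * ‖x‖ ^ 2) ≤ 1 := Real.exp_le_one_iff.2 (by
      have : 0 ≤ a * ‖x‖ ^ 2 := by positivity
      linarith)
    linarith [Real.exp_pos (-a * s ^ 2)]
  have hcd : ∀ s : ℝ, ContDiff ℝ 2
      (fun y : Euc n => Real.exp (-a * ‖y‖ ^ 2) - Real.exp (-a * s ^ 2)) := fun s =>
    ((contDiff_const.mul (contDiff_norm_sq ℝ)).exp).sub contDiff_const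
  -- `w` need not extend to the sphere of radius `ρ`, so the barrier is made to vanish at radius `s
  -- < ρ`; `hlim` then lets `s` tend to `ρ`.
  have hcomp : ∀ s, s < ρ → ∀ x : Euc n, ‖x‖ ≤ s →
      δ * (Real.exp (-a * ‖x‖ ^ 2) - Real.exp (-a * s ^ 2)) ≤ w x := by
    intro s hs x hx
    rcases lt_or_ge ‖x‖ r₁ with hxr | hxr
    · exact (mul_le_of_le_one_right hδ0.le (hexp s x)).trans (hwr x (hxr.trans hr₁r)).le
    set K : Set (Euc n) := Metric.closedBall 0 s ∩ {y | r₁ ≤ ‖y‖} with hK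
    have hKc : IsCompact K := (isCompact_closedBall _ _).inter_right
      (isClosed_le continuous_const continuous_norm)
    have hKb : K ⊆ Metric.ball 0 ρ := fun y hy => by
      have := hy.1
      rw [mem_closedBall_zero_iff] at this
      exact mem_ball_zero_iff.2 (this.trans_lt hs)
    set z : Euc n → ℝ := fun y =>
      δ⁻¹ * w y - (Real.exp (-a * ‖y‖ ^ 2) - Real.exp (-a * s ^ 2)) with hz
    have hzc : ContinuousOn z K :=
      ((hw.continuousOn.mono hKb).const_smul δ⁻¹).sub (hcd s).continuous.continuousOn
    obtain ⟨y, hyK, hymin⟩ := hKc.exists_isMinOn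
      ⟨x, mem_closedBall_zero_iff.2 hx, hxr⟩ hzc
    -- A negative minimum avoids the outer sphere, where the barrier vanishes, and the inner one,
    -- where `w > δ` and the barrier is at most 1. In between, `Δz < 0` forbids a local minimum.
    have hy0 : 0 ≤ z y := by
      by_contra! hneg
      have hys : ‖y‖ ≤ s := mem_closedBall_zero_iff.1 hyK.1
      have hwy := hnonneg y (hKb hyK)
      have hys' : ‖y‖ < s := by
        refine lt_of_le_of_ne hys fun h => ?_
        simp only [hz, h, sub_self, sub_zero] at hneg
        have : 0 ≤ δ⁻¹ * w y := by positivity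
        linarith
      have hyr : r₁ < ‖y‖ := by
        refine lt_of_le_of_ne hyK.2 fun h => ?_
        have h1 := hwr y (by rw [← h]; exact hr₁r)
        have h2 : 1 ≤ δ⁻¹ * w y := by
          rw [← inv_mul_cancel₀ hδ0.ne']
          gcongr
        have := hexp s y
        simp only [hz] at hneg
        linarith
      have hloc : IsLocalMin z y := by
        refine hymin.isLocalMin ?_
        filter_upwards [Metric.isOpen_ball.mem_nhds (mem_ball_zero_iff.2 hys'),
          (isOpen_lt continuous_const continuous_norm).mem_nhds hyr] with q h1 h2
        exact ⟨Metric.ball_subset_closedBall h1, le_of_lt h2⟩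
      have hwy' := hwAt y (hKb hyK)
      have h1 := laplacian_nonneg_of_isLocalMin
        ((contDiffAt_const.mul hwy').sub (hcd s).contDiffAt) hloc
      rw [laplacian_const_mul_sub _ hwy' (hcd s).contDiffAt] at h1
      have h2 := laplacian_gaussian_sub_pos (s := Real.exp (-a * s ^ 2)) ha0 (ha1 y hyK.2)
      have h3 : δ⁻¹ * Laplacian.laplacian w y ≤ 0 :=
        mul_nonpos_of_nonneg_of_nonpos (by positivity) (hsuper y (hKb hyK))
      linarith
    have hx0 : 0 ≤ z x := hy0.trans (hymin ⟨mem_closedBall_zero_iff.2 hx, hxr⟩)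
    have : δ * z x = w x - δ * (Real.exp (-a * ‖x‖ ^ 2) - Real.exp (-a * s ^ 2)) := by
      simp only [hz]
      field_simp
    nlinarith [mul_nonneg hδ0.le hx0]
  have hlim : ∀ x ∈ Metric.ball (0 : Euc n) ρ,
      δ * (Real.exp (-a * ‖x‖ ^ 2) - Real.exp (-a * ρ ^ 2)) ≤ w x := by
    intro x hx
    rw [mem_ball_zero_iff] at hx
    have hc : Continuous fun s : ℝ =>
        δ * (Real.exp (-a * ‖x‖ ^ 2) - Real.exp (-a * s ^ 2)) := by fun_prop
    refine le_of_tendsto (hc.continuousWithinAt (s := Iio ρ) (x := ρ)).tendsto ?_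
    filter_upwards [self_mem_nhdsWithin,
      mem_nhdsWithin_of_mem_nhds (lt_mem_nhds hx)] with s h1 h2
    exact hcomp s h1 x (le_of_lt h2)
  -- The slope comes from `1 + t ≤ exp t` at `t = a * (ρ ^ 2 - ‖x‖ ^ 2)`, which is at least `a * ρ *
  -- (ρ - ‖x‖)`.
  refine ⟨δ * (Real.exp (-a * ρ ^ 2) * (a * ρ)), by positivity, fun x hx => ?_⟩
  refine le_trans ?_ (hlim x hx)
  rw [mem_ball_zero_iff] at hx
  rw [mul_assoc]
  gcongr
  have h1 : Real.exp (-a * ‖x‖ ^ 2)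
      = Real.exp (-a * ρ ^ 2) * Real.exp (a * (ρ ^ 2 - ‖x‖ ^ 2)) := by
    rw [← Real.exp_add]
    congr 1
    ring
  have h2 := Real.add_one_le_exp (a * (ρ ^ 2 - ‖x‖ ^ 2))
  have h3 : a * ρ * (ρ - ‖x‖) ≤ a * (ρ ^ 2 - ‖x‖ ^ 2) := by
    have : 0 ≤ a * ‖x‖ * (ρ - ‖x‖) := by
      have := sub_nonneg.2 hx.le
      positivity
    linarith
  calc Real.exp (-a * ρ ^ 2) * (a * ρ) * (ρ - ‖x‖)
      = Real.exp (-a * ρ ^ 2) * (a * ρ * (ρ - ‖x‖)) := by ring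
    _ ≤ Real.exp (-a * ρ ^ 2) * (Real.exp (a * (ρ ^ 2 - ‖x‖ ^ 2)) - 1) := by
        gcongr
        linarith
    _ = _ := by rw [h1]; ring

/-- Strong minimum principle. -/
theorem pos_or_eq_zero_of_superharmonic {S : Set (Euc n)} (hS : IsOpen S) (hSc : IsPreconnected S)
    {w : Euc n → ℝ} (hw : ContDiffOn ℝ 2 w S)
    (hsuper : ∀ x ∈ S, Laplacian.laplacian w x ≤ 0) (hnonneg : ∀ x ∈ S, 0 ≤ w x) :
    (∀ x ∈ S, 0 < w x) ∨ ∀ x ∈ S, w x = 0 := by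
  set V := S ∩ w ⁻¹' Ioi 0 with hV
  have hVo : IsOpen V := hw.continuousOn.isOpen_inter_preimage hS isOpen_Ioi
  rcases V.eq_empty_or_nonempty with he | ⟨x₀, hx₀⟩
  · refine Or.inr fun x hx => (hnonneg x hx).antisymm' (not_lt.1 fun h => ?_)
    exact (he ▸ (⟨hx, h⟩ : x ∈ V) : x ∈ (∅ : Set (Euc n)))
  left
  suffices h : S ⊆ V from fun x hx => (h hx).2
  -- It remains to see that `V` is relatively closed in `S`. A limit point `x` lies in a ball inside
  -- `S` centred at some `y ∈ V`, and Hopf's bound on that ball gives `w x > 0`.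
  refine hSc.subset_of_closure_inter_subset hVo ⟨x₀, hx₀.1, hx₀⟩ ?_
  rintro x ⟨hxV, hxS⟩
  obtain ⟨ε, hε, hball⟩ := Metric.isOpen_iff.1 hS x hxS
  obtain ⟨y, hyV, hxy⟩ := Metric.mem_closure_iff.1 hxV (ε / 2) (half_pos hε)
  have hmaps : ∀ z ∈ Metric.ball (0 : Euc n) (ε / 2), y + z ∈ S := fun z hz => by
    refine hball ?_
    have h1 : dist (y + z) y < ε / 2 := by simpa using hz
    have h2 := dist_triangle (y + z) y x
    rw [dist_comm y x] at h2
    exact Metric.mem_ball.2 (by linarith)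
  obtain ⟨c, hc, hle⟩ := exists_mul_sub_norm_le_of_superharmonic (half_pos hε)
    (w := fun z => w (y + z))
    (hw.comp (contDiff_const.add contDiff_id).contDiffOn hmaps)
    (fun z hz => by rw [laplacian_comp_const_add]; exact hsuper _ (hmaps z hz))
    (fun z hz => hnonneg _ (hmaps z hz)) (by simpa using hyV.2)
  have hz : ‖x - y‖ < ε / 2 := by rwa [← dist_eq_norm]
  have := hle (x - y) (mem_ball_zero_iff.2 hz)
  rw [add_sub_cancel] at this
  exact ⟨hxS, lt_of_lt_of_le (mul_pos hc (sub_pos.2 hz)) this⟩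

/-! ### Comparison with a first eigenfunction. -/

/-- In dimension 0 the Laplacian is an empty sum, so the equation would force `lam * v 0 = 0`.
Positive dimension is what makes spheres nonempty later. -/
theorem IsDirichletRadius.dim_pos {lam R : ℝ} (hlam : 0 < lam) (h : IsDirichletRadius n lam R) :
    0 < n := by
  obtain ⟨hR, v, -, -, heq, hpos, -⟩ := h
  rcases Nat.eq_zero_or_pos n with rfl | hn
  · have h1 := heq 0 (Metric.mem_ball_self hR)
    have h2 := hpos 0 (Metric.mem_ball_self hR)
    rw [InnerProductSpace.laplacian_eq_iteratedFDeriv_orthonormalBasis _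
      (EuclideanSpace.basisFun (Fin 0) ℝ)] at h1
    simp only [Finset.univ_eq_empty, Finset.sum_empty, zero_add] at h1
    exact absurd h1 (mul_pos hlam h2).ne'
  · exact hn

/-- If a multiple of a positive supersolution dominates an eigenfunction, the difference is
superharmonic. -/
theorem laplacian_const_mul_sub_nonpos {lam c : ℝ} (hlam : 0 ≤ lam) (hc : 0 ≤ c)
    {U v : Euc n → ℝ} {x : Euc n} (hU : ContDiffAt ℝ 2 U x) (hv : ContDiffAt ℝ 2 v x)
    (hUsuper : Laplacian.laplacian U x + lam * U x ≤ 0)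
    (hveq : Laplacian.laplacian v x + lam * v x = 0) (hle : v x ≤ c * U x) :
    Laplacian.laplacian (fun y => c * U y - v y) x ≤ 0 := by
  rw [laplacian_const_mul_sub c hU hv]
  nlinarith [mul_nonneg hlam (sub_nonneg.2 hle), mul_nonneg hc (neg_nonneg.2 hUsuper)]

/-- A supersolution cannot be positive on the closed ball of radius `R_λ`. -/
theorem IsDirichletRadius.not_forall_closedBall_pos {lam R : ℝ} (hlam : 0 < lam)
    (hR : IsDirichletRadius n lam R) {U : Euc n → ℝ}
    (hU : ContDiffOn ℝ 2 U (Metric.ball 0 R)) (hUc : ContinuousOn U (Metric.closedBall 0 R))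
    (hsuper : ∀ x ∈ Metric.ball (0 : Euc n) R, Laplacian.laplacian U x + lam * U x ≤ 0) :
    ¬ ∀ x ∈ Metric.closedBall (0 : Euc n) R, 0 < U x := by
  intro hpos
  have hn := hR.dim_pos hlam
  obtain ⟨hR0, v, hv, hvc, hveq, hvpos, hvzero⟩ := hR
  have hbc : Metric.ball (0 : Euc n) R ⊆ Metric.closedBall 0 R := Metric.ball_subset_closedBall
  obtain ⟨x₀, hx₀, hmax⟩ := (isCompact_closedBall (0 : Euc n) R).exists_isMaxOn
    ⟨0, Metric.mem_closedBall_self hR0.le⟩ (hvc.div hUc fun x hx => (hpos x hx).ne')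
  set c := v x₀ / U x₀ with hc
  have hle : ∀ x ∈ Metric.closedBall (0 : Euc n) R, v x ≤ c * U x := fun x hx =>
    (div_le_iff₀ (hpos x hx)).1 (hmax hx)
  have hc0 : 0 < c := by
    have h1 := hle 0 (Metric.mem_closedBall_self hR0.le)
    exact pos_of_mul_pos_left ((hvpos 0 (Metric.mem_ball_self hR0)).trans_le h1)
      (hpos 0 (Metric.mem_closedBall_self hR0.le)).le
  -- On the sphere `v = 0`, which would give `c = 0`.
  have hx₀b : x₀ ∈ Metric.ball (0 : Euc n) R := by
    refine mem_ball_zero_iff.2 (lt_of_le_of_ne (mem_closedBall_zero_iff.1 hx₀) fun h => ?_)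
    rw [hc, hvzero x₀ (mem_sphere_zero_iff_norm.2 h), zero_div] at hc0
    exact hc0.false
  have hAt : ∀ {g : Euc n → ℝ}, ContDiffOn ℝ 2 g (Metric.ball 0 R) →
      ∀ x ∈ Metric.ball (0 : Euc n) R, ContDiffAt ℝ 2 g x := fun hg x hx =>
    hg.contDiffAt (Metric.isOpen_ball.mem_nhds hx)
  have hx₀z : c * U x₀ - v x₀ = 0 := by
    rw [hc, div_mul_cancel₀ _ (hpos x₀ hx₀).ne', sub_self]
  rcases pos_or_eq_zero_of_superharmonic Metric.isOpen_ball
    (convex_ball (0 : Euc n) R).isPreconnected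
    (w := fun y => c * U y - v y) ((contDiffOn_const.mul hU).sub hv)
    (fun x hx => laplacian_const_mul_sub_nonpos hlam.le hc0.le (hAt hU x hx) (hAt hv x hx)
      (hsuper x hx) (hveq x hx) (hle x (hbc hx)))
    (fun x hx => sub_nonneg.2 (hle x (hbc hx))) with h | h
  · exact (h x₀ hx₀b).ne' hx₀z
  · have : Nonempty (Fin n) := ⟨⟨0, hn⟩⟩
    obtain ⟨q, hq⟩ := (NormedSpace.sphere_nonempty (x := (0 : Euc n)) (r := R)).2 hR0.le
    have hqc : q ∈ Metric.closedBall (0 : Euc n) R := Metric.sphere_subset_closedBall hq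
    have hcl : EqOn (fun y => c * U y - v y) (fun _ => 0) (Metric.closedBall 0 R) := by
      refine EqOn.of_subset_closure h ((continuousOn_const.mul hUc).sub hvc) continuousOn_const
        hbc ?_
      rw [closure_ball _ hR0.ne']
    have h1 := hcl hqc
    simp only [hvzero q hq, sub_zero] at h1
    exact (mul_pos hc0 (hpos q hqc)).ne' h1

/-- An eigenfunction of a strictly larger ball would be a positive solution on the smaller closed
ball. Applied both ways, this makes the radius unique. -/
theorem IsDirichletRadius.le {lam R R' : ℝ} (hlam : 0 < lam) (h : IsDirichletRadius n lam R)
    (h' : IsDirichletRadius n lam R') : R' ≤ R := by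
  by_contra! hlt
  obtain ⟨-, v, hv, -, hveq, hvpos, -⟩ := h'
  have hsub : Metric.closedBall (0 : Euc n) R ⊆ Metric.ball 0 R' :=
    Metric.closedBall_subset_ball hlt
  exact h.not_forall_closedBall_pos hlam (hv.mono (Metric.ball_subset_ball hlt.le))
    (hv.continuousOn.mono hsub) (fun x hx => (hveq x (Metric.ball_subset_ball hlt.le hx)).le)
    fun x hx => hvpos x (hsub hx)

/-- A function of class `C¹` vanishing on a sphere is bounded inside by a multiple of the distance
to the sphere. -/
theorem exists_le_mul_sub_norm {R : ℝ} (hR : 0 < R) (hn : 0 < n) {v : Euc n → ℝ}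
    (hv : ContDiff ℝ 1 v) (hzero : ∀ x ∈ Metric.sphere (0 : Euc n) R, v x = 0) :
    ∃ L > 0, ∀ x ∈ Metric.ball (0 : Euc n) R, v x ≤ L * (R - ‖x‖) := by
  obtain ⟨C, hC⟩ := (isCompact_closedBall (0 : Euc n) R).exists_bound_of_continuousOn
    (hv.continuous_fderiv (by simp)).continuousOn
  refine ⟨max C 1, by positivity, fun x hx => ?_⟩
  rw [mem_ball_zero_iff] at hx
  -- `q` is a nearest point of the sphere: the radial projection of `x`, or any point of the sphere
  -- when `x = 0`.
  obtain ⟨q, hq, hxq⟩ : ∃ q : Euc n, ‖q‖ = R ∧ ‖x - q‖ = R - ‖x‖ := by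
    rcases eq_or_ne x 0 with rfl | hx0
    · have : Nonempty (Fin n) := ⟨⟨0, hn⟩⟩
      obtain ⟨q, hq⟩ := (NormedSpace.sphere_nonempty (x := (0 : Euc n)) (r := R)).2 hR.le
      rw [mem_sphere_zero_iff_norm] at hq
      exact ⟨q, hq, by simp [hq]⟩
    · have hx' : 0 < ‖x‖ := norm_pos_iff.2 hx0
      refine ⟨(R / ‖x‖) • x, ?_, ?_⟩
      · rw [norm_smul, Real.norm_of_nonneg (by positivity), div_mul_cancel₀ _ hx'.ne']
      · have h1 : x - (R / ‖x‖) • x = (1 - R / ‖x‖) • x := by rw [sub_smul, one_smul]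
        have h2 : 1 - R / ‖x‖ ≤ 0 := by
          rw [sub_nonpos, one_le_div hx']
          exact hx.le
        rw [h1, norm_smul, Real.norm_of_nonpos h2]
        field_simp
        ring
  have := (convex_closedBall (0 : Euc n) R).norm_image_sub_le_of_norm_fderiv_le
    (fun y _ => (hv.differentiable (by simp)).differentiableAt) hC
    (mem_closedBall_zero_iff.2 hq.le) (mem_closedBall_zero_iff.2 hx.le)
  rw [hzero q (mem_sphere_zero_iff_norm.2 hq), sub_zero, hxq] at this
  refine (le_abs_self _).trans (this.trans ?_)
  have := sub_nonneg.2 hx.le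
  gcongr
  exact le_max_left _ _

/-- A positive supersolution on the open ball of radius `R_λ` is a multiple of a first
eigenfunction. -/
theorem exists_const_mul_eq_eigenfunction {lam R : ℝ} (hlam : 0 < lam) (hR : 0 < R) (hn : 0 < n)
    {v : Euc n → ℝ} (hv : ContDiff ℝ 2 v)
    (hveq : ∀ x, Laplacian.laplacian v x + lam * v x = 0)
    (hvpos : ∀ x ∈ Metric.ball (0 : Euc n) R, 0 < v x)
    (hvzero : ∀ x ∈ Metric.sphere (0 : Euc n) R, v x = 0)
    {U : Euc n → ℝ} (hU : ContDiffOn ℝ 2 U (Metric.ball 0 R))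
    (hUpos : ∀ x ∈ Metric.ball (0 : Euc n) R, 0 < U x)
    (hsuper : ∀ x ∈ Metric.ball (0 : Euc n) R, Laplacian.laplacian U x + lam * U x ≤ 0) :
    ∃ c > 0, ∀ x ∈ Metric.ball (0 : Euc n) R, U x = c * v x := by
  set B := Metric.ball (0 : Euc n) R with hB
  have h0 : (0 : Euc n) ∈ B := Metric.mem_ball_self hR
  have hdist : ∀ x ∈ B, 0 < R - ‖x‖ := fun x hx => sub_pos.2 (mem_ball_zero_iff.1 hx)
  obtain ⟨L, hL, hvL⟩ := exists_le_mul_sub_norm hR hn (hv.of_le (by norm_num)) hvzero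
  obtain ⟨δ, hδ, hUδ⟩ := exists_mul_sub_norm_le_of_superharmonic hR hU
    (fun x hx => by linarith [hsuper x hx, mul_pos hlam (hUpos x hx)])
    (fun x hx => (hUpos x hx).le) (hUpos 0 h0)
  have hbdd : BddAbove ((fun x => v x / U x) '' B) := by
    refine ⟨L / δ, ?_⟩
    rintro _ ⟨x, hx, rfl⟩
    rw [div_le_div_iff₀ (hUpos x hx) hδ]
    calc v x * δ ≤ L * (R - ‖x‖) * δ := by gcongr; exact hvL x hx
      _ = L * (δ * (R - ‖x‖)) := by ring
      _ ≤ L * U x := by gcongr; exact hUδ x hx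
  set c := sSup ((fun x => v x / U x) '' B) with hc
  have hle : ∀ x ∈ B, v x ≤ c * U x := fun x hx =>
    (div_le_iff₀ (hUpos x hx)).1 (le_csSup hbdd ⟨x, hx, rfl⟩)
  have hc0 : 0 < c := pos_of_mul_pos_left ((hvpos 0 h0).trans_le (hle 0 h0)) (hUpos 0 h0).le
  have hwcd : ContDiffOn ℝ 2 (fun y => c * U y - v y) B :=
    (contDiffOn_const.mul hU).sub hv.contDiffOn
  have hwsuper : ∀ x ∈ B, Laplacian.laplacian (fun y => c * U y - v y) x ≤ 0 := fun x hx =>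
    laplacian_const_mul_sub_nonpos hlam.le hc0.le
      (hU.contDiffAt (Metric.isOpen_ball.mem_nhds hx)) hv.contDiffAt (hsuper x hx) (hveq x)
      (hle x hx)
  have hwnonneg : ∀ x ∈ B, 0 ≤ c * U x - v x := fun x hx => sub_nonneg.2 (hle x hx)
  rcases pos_or_eq_zero_of_superharmonic Metric.isOpen_ball
    (convex_ball (0 : Euc n) R).isPreconnected hwcd hwsuper hwnonneg with h | h
  · exfalso
    obtain ⟨η, hη, hwη⟩ := exists_mul_sub_norm_le_of_superharmonic hR hwcd hwsuper hwnonneg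
      (h 0 h0)
    have hk : 0 < 1 + η / L := by positivity
    -- Since `v ≤ L * (R - ‖x‖)`, the Hopf bound gives `c * U - v ≥ (η / L) * v`, so `c` could be
    -- lowered by the factor `1 + η / L`.
    have hbound : c ≤ c / (1 + η / L) := by
      refine csSup_le ⟨_, 0, h0, rfl⟩ ?_
      rintro _ ⟨x, hx, rfl⟩
      rw [div_le_div_iff₀ (hUpos x hx) hk]
      have h1 := hwη x hx
      have h2 : η / L * v x ≤ η * (R - ‖x‖) := by
        calc η / L * v x ≤ η / L * (L * (R - ‖x‖)) := by gcongr; exact hvL x hx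
          _ = η * (R - ‖x‖) := by field_simp
      linarith
    rw [le_div_iff₀ hk] at hbound
    have : 0 < c * (η / L) := by positivity
    linarith
  · refine ⟨c⁻¹, inv_pos.2 hc0, fun x hx => ?_⟩
    rw [← sub_eq_zero.1 (h x hx), inv_mul_cancel_left₀ hc0.ne']

/-! ### Boundary regularity and conclusion. -/

/-- At a boundary point interior to the closure, the defining function would have a local maximum,
against its nonzero gradient. This excludes slits and isolated boundary points. -/
theorem HasC1Boundary.interior_closure_subset {Ω : Set (Euc n)} (h : HasC1Boundary Ω) :
    interior (closure Ω) ⊆ Ω := by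
  intro q hq
  by_contra hqΩ
  have hqf : q ∈ frontier Ω :=
    ⟨interior_subset hq, fun hi => hqΩ (interior_subset hi)⟩
  obtain ⟨ρ, hρ, hρq, hgrad, hev⟩ := h q hqf
  have hcl : ∀ᶠ x in 𝓝 q, ρ x ≤ 0 := by
    filter_upwards [mem_interior_iff_mem_nhds.1 hq, hev.eventually_nhds,
      hρ.eventually (by simp)] with x hx hxev hxc
    rw [mem_closure_iff_frequently] at hx
    by_contra! hpos
    have h1 := hxc.continuousAt.eventually (lt_mem_nhds hpos)
    obtain ⟨y, hy, hy1, hy2⟩ := (hx.and_eventually (h1.and hxev)).exists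
    exact absurd (hy2.1 hy) (not_lt.2 hy1.le)
  have hmax : IsLocalMax ρ q := hcl.mono fun x hx => by simpa only [hρq] using hx
  refine hgrad ?_
  rw [gradient, hmax.fderiv_eq_zero, map_zero]

end SuperharmonicFunctions

theorem proposition3p1 {n : ℕ} (lam R : ℝ) (hlam : 0 < lam) (hR : IsDirichletRadius n lam R)
    (f : ℝ → ℝ) (hf : ∀ t : ℝ, 0 < t → lam * t ≤ f t)
    (Ω : Set (Euc n)) (hΩ_open : IsOpen Ω) (hΩ_conn : IsConnected Ω)
    (u : Euc n → ℝ) (hu_reg : ContDiffOn ℝ 2 u Ω) (hu_pos : ∀ x ∈ Ω, 0 < u x)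
    (hu_eq : ∀ x ∈ Ω, Laplacian.laplacian u x + f (u x) = 0) :
    (∀ p : Euc n, ¬ Metric.closedBall p R ⊆ Ω) ∧
    (∀ α : ℝ, α < 0 → HasC1Boundary Ω → ContDiffOn ℝ 1 u (closure Ω) →
      OverdeterminedBoundary Ω u α →
      (∀ p : Euc n, ¬ Metric.closedBall p R ⊆ closure Ω) ∨
        ∃ p : Euc n, Ω = Metric.ball p R) := by
  have hR0 : 0 < R := hR.1
  have hshift : ∀ {p : Euc n}, Metric.ball p R ⊆ Ω →
      (∀ x ∈ Metric.ball (0 : Euc n) R, p + x ∈ Ω) := fun hp x hx => by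
    refine hp ?_
    rw [Metric.mem_ball, dist_self_add_left]
    exact mem_ball_zero_iff.1 hx
  have hreg : ∀ {p : Euc n}, Metric.ball p R ⊆ Ω →
      ContDiffOn ℝ 2 (fun x => u (p + x)) (Metric.ball 0 R) := fun hp =>
    hu_reg.comp (contDiff_const.add contDiff_id).contDiffOn (hshift hp)
  have hsuper : ∀ {p : Euc n}, Metric.ball p R ⊆ Ω → ∀ x ∈ Metric.ball (0 : Euc n) R,
      Laplacian.laplacian (fun x => u (p + x)) x + lam * u (p + x) ≤ 0 := fun hp x hx => by
    rw [laplacian_comp_const_add]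
    linarith [hu_eq _ (hshift hp x hx), hf _ (hu_pos _ (hshift hp x hx))]
  refine ⟨fun p hp => ?_, fun α _ hC1 hu1 _ => or_iff_not_imp_left.2 fun hne => ?_⟩
  · have hp' : Metric.ball p R ⊆ Ω := Metric.ball_subset_closedBall.trans hp
    have hmaps : ∀ x ∈ Metric.closedBall (0 : Euc n) R, p + x ∈ Ω := fun x hx => by
      refine hp ?_
      rw [Metric.mem_closedBall, dist_self_add_left]
      exact mem_closedBall_zero_iff.1 hx
    exact hR.not_forall_closedBall_pos hlam (hreg hp')
      (hu_reg.continuousOn.comp (by fun_prop) hmaps) (hsuper hp') fun x hx => hu_pos _ (hmaps x hx)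
  push Not at hne
  obtain ⟨p, hp⟩ := hne
  refine ⟨p, ?_⟩
  have hn := hR.dim_pos hlam
  obtain ⟨R', hR'0, hR', v, hv, hveq, hvpos, hvzero⟩ := exists_isDirichletRadius hn hlam
  -- Uniqueness of the radius replaces the eigenfunction in `hR`, only continuous up to the sphere,
  -- by one that is `C²` on the whole space, as the linear upper bound requires.
  obtain rfl : R = R' := le_antisymm (hR'.le hlam hR) (hR.le hlam hR')
  have hball : Metric.ball p R ⊆ Ω := by
    refine Subset.trans ?_ hC1.interior_closure_subset
    exact interior_maximal (Metric.ball_subset_closedBall.trans hp) Metric.isOpen_ball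
  obtain ⟨c, -, huv⟩ := exists_const_mul_eq_eigenfunction hlam hR0 hn hv hveq hvpos hvzero
    (hreg hball) (fun x hx => hu_pos _ (hshift hball x hx)) (hsuper hball)
  have hsphere : ∀ q ∈ Metric.sphere p R, q ∉ Ω := by
    intro q hq hqΩ
    have heq : EqOn u (fun y => c * v (y - p)) (Metric.closedBall p R) := by
      refine EqOn.of_subset_closure (s := Metric.ball p R) (fun y hy => ?_)
        (hu1.continuousOn.mono hp) ?_ Metric.ball_subset_closedBall ?_
      · have := huv (y - p) (mem_ball_zero_iff.2 (mem_ball_iff_norm.1 hy))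
        simpa using this
      · exact (continuous_const.mul
          (hv.continuous.comp (continuous_id.sub continuous_const))).continuousOn
      · rw [closure_ball _ hR0.ne']
    have h1 := heq (Metric.sphere_subset_closedBall hq)
    have h2 := hvzero (q - p) (mem_sphere_zero_iff_norm.2 (mem_sphere_iff_norm.1 hq))
    simp only [h2, mul_zero] at h1
    exact (hu_pos q hqΩ).ne' h1
  refine Subset.antisymm ?_ hball
  have hp0 : p ∈ Metric.ball p R := Metric.mem_ball_self hR0
  -- The sphere misses `Ω`, so the ball is relatively closed, as well as open, in the connected set
  -- `Ω`.
  refine hΩ_conn.isPreconnected.subset_of_closure_inter_subset Metric.isOpen_ball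
    ⟨p, hball hp0, hp0⟩ ?_
  rintro x ⟨hx, hxΩ⟩
  rw [closure_ball _ hR0.ne', ← Metric.ball_union_sphere] at hx
  exact hx.resolve_right fun h => hsphere x h hxΩ
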